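/- A Hadamard space is a complete metric space $(X,d)$ such that for all $x_0,x_1\in X$ there is $y\in X$ with $$d(z,y)^2\le \tfrac12 d(z,x_0)^2+\tfrac12 d(z,x_1)^2-\tfrac14 d(x_0,x_1)^2\qquad\text{for all } z\in X.$$ Let $s\ge 0$ be an integer and let $\mathbf a=(a_i)_{i\in\mathbb Z^s}$ be a finitely supported family of nonnegative real numbers satisfying the basic sum rule $\sum_{j\in\mathbb Z^s}a_{i-2j}=1$ for all $i\in\mathbb Z^s$. For a Hadamard space $X$, let $\ell^\infty(\mathbb Z^s,X)$ be the set of bounded maps $\mathbb Z^s\to X$. The barycentric refinement scheme $S:\ell^\infty(\mathbb Z^s,X)\to\ell^\infty(\mathbb Z^s,X)$ with mask $\mathbf a$ is defined by $$(Sx)_i=\operatorname{argmin}_{p\in X}\ \sum_{j\in\mathbb Z^s}a_{i-2j}\,d(x_j,p)^2 ,$$ the minimizer being unique. Its linear counterpart is the map $\widetilde S:\ell^\infty(\mathbb Z^s,\mathbb R)\to\ell^\infty(\mathbb Z^s,\mathbb R)$, $(\widetilde Sx)_i=\sum_{j\in\mathbb Z^s}a_{i-2j}x_j$. A map $S:\ell^\infty(\mathbb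 Z^s,X)\to\ell^\infty(\mathbb Z^s,X)$ is called convergent if for every $x\in\ell^\infty(\mathbb Z^s,X)$ there is a continuous function $f:\mathbb R^s\to X$ with $$\sup_{j\in\mathbb Z^s} d\bigl(f(j/2^n),(S^nx)_j\bigr)\to 0\qquad\text{as } n\to\infty .$$ Theorem. For every such mask $\mathbf a$ the following are equivalent: (1) the barycentric refinement scheme with mask $\mathbf a$ converges on every Hadamard space $X$; (2) the barycentric refinement scheme with mask $\mathbf a$ converges on the real line $X=\mathbb R$; (3) the linear scheme $\widetilde S$ with mask $\mathbf a$ converges. -/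

import Mathlib

open Filter Topology

/-- A Hadamard (global NPC) space: a complete metric space in which any two points `x₀`, `x₁`
admit a point `y` such that the Hadamard inequality holds for all `z`. -/
class IsHadamard (X : Type*) [MetricSpace X] : Prop extends CompleteSpace X where
  exists_midpoint : ∀ x₀ x₁ : X, ∃ y : X, ∀ z : X,
    dist z y ^ 2 ≤ 1 / 2 * dist z x₀ ^ 2 + 1 / 2 * dist z x₁ ^ 2 - 1 / 4 * dist x₀ x₁ ^ 2

/-- The real line is a Hadamard space. -/
instance instIsHadamardReal : IsHadamard ℝ where
  exists_midpoint x₀ x₁ := ⟨(x₀ + x₁) / 2, fun z => by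
    simp only [Real.dist_eq, sq_abs]
    exact le_of_eq (by ring)⟩

/-- The space `ℓ^∞(ℤ^s, X)` of bounded sequences indexed by `ℤ^s` with values in `X`. -/
def BoundedSeq (s : ℕ) (X : Type*) [MetricSpace X] : Type _ :=
  {x : (Fin s → ℤ) → X // Bornology.IsBounded (Set.range x)}

instance instCoeFunBoundedSeq (s : ℕ) (X : Type*) [MetricSpace X] :
    CoeFun (BoundedSeq s X) (fun _ => (Fin s → ℤ) → X) := ⟨Subtype.val⟩

/-- A refinement scheme is a self-map of `ℓ^∞(ℤ^s, X)`. -/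
abbrev RefinementScheme (s : ℕ) (X : Type*) [MetricSpace X] : Type _ :=
  BoundedSeq s X → BoundedSeq s X

/-- A refinement scheme `S` is convergent if for every bounded `x` there is a continuous
`f : ℝ^s → X` with `sup_j d(f(j / 2^n), (S^n x)_j) → 0` as `n → ∞`. -/
def RefinementScheme.Convergent {s : ℕ} {X : Type*} [MetricSpace X]
    (S : RefinementScheme s X) : Prop :=
  ∀ x : BoundedSeq s X, ∃ f : (Fin s → ℝ) → X, Continuous f ∧
    Tendsto (fun n : ℕ => ⨆ j : Fin s → ℤ, edist (f (fun k => (j k : ℝ) / 2 ^ n)) ((S^[n] x) j))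
      atTop (𝓝 0)

/-- A mask: a nonnegative, finitely supported, real-valued `s`-variate sequence `a` satisfying the
basic sum rule. -/
structure Mask (s : ℕ) where
  coeff : (Fin s → ℤ) → ℝ
  nonneg : ∀ i, 0 ≤ coeff i
  finite_support : coeff.support.Finite
  sum_rule : ∀ i : Fin s → ℤ, ∑ᶠ j : Fin s → ℤ, coeff (i - 2 • j) = 1

namespace Mask

variable {s : ℕ} (a : Mask s)

/-- For fixed `i`, only finitely many of the weights `a_{i-2j}` are nonzero. -/
lemma finite_weights (i : Fin s → ℤ) :
    (Function.support fun j : Fin s → ℤ => a.coeff (i - 2 • j)).Finite := by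
  refine Set.Finite.preimage (f := fun j : Fin s → ℤ => i - 2 • j) ?_ a.finite_support
  intro j _ k _ h
  funext t
  have ht : i t - 2 • j t = i t - 2 • k t := congrFun h t
  simp only [nsmul_eq_mul, Nat.cast_ofNat] at ht
  omega

/-- The sum `∑_j a_{i-2j} u_j` is a finite sum. -/
lemma finsum_eq (i : Fin s → ℤ) (u : (Fin s → ℤ) → ℝ) :
    ∑ᶠ j, a.coeff (i - 2 • j) * u j
      = ∑ j ∈ (a.finite_weights i).toFinset, a.coeff (i - 2 • j) * u j := by
  apply finsum_eq_sum_of_support_subset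
  intro j hj
  have hj' : a.coeff (i - 2 • j) * u j ≠ 0 := hj
  simpa using left_ne_zero_of_mul hj'

lemma sum_weights (i : Fin s → ℤ) :
    ∑ j ∈ (a.finite_weights i).toFinset, a.coeff (i - 2 • j) = 1 := by
  have h := a.finsum_eq i (fun _ => 1)
  simp only [mul_one] at h
  rw [← h, a.sum_rule]

/-- The function `∑_j a_{i-2j} d²(x_j, ·)` on `X`. -/
noncomputable def energy {X : Type*} [MetricSpace X] (x : (Fin s → ℤ) → X) (i : Fin s → ℤ)
    (p : X) : ℝ :=
  ∑ᶠ j : Fin s → ℤ, a.coeff (i - 2 • j) * dist (x j) p ^ 2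

/-- On a Hadamard space, `∑_j a_{i-2j} d²(x_j, ·)` has exactly one minimizer. -/
lemma existsUnique_minimizer {X : Type*} [MetricSpace X] [IsHadamard X]
    (x : (Fin s → ℤ) → X) (i : Fin s → ℤ) :
    ∃! p : X, ∀ q : X, a.energy x i p ≤ a.energy x i q := by
  have hE : ∀ p, a.energy x i p =
      ∑ j ∈ (a.finite_weights i).toFinset, a.coeff (i - 2 • j) * dist (x j) p ^ 2 :=
    fun p => a.finsum_eq i _
  have hmid : ∀ p q : X, ∃ m, a.energy x i m ≤
      1 / 2 * a.energy x i p + 1 / 2 * a.energy x i q - 1 / 4 * dist p q ^ 2 := by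
    intro p q
    obtain ⟨m, hm⟩ := IsHadamard.exists_midpoint p q
    refine ⟨m, ?_⟩
    have h1 : 1 / 4 * dist p q ^ 2 = ∑ j ∈ (a.finite_weights i).toFinset,
        a.coeff (i - 2 • j) * (1 / 4 * dist p q ^ 2) := by
      rw [← Finset.sum_mul, a.sum_weights, one_mul]
    rw [hE, hE, hE, h1, Finset.mul_sum, Finset.mul_sum, ← Finset.sum_add_distrib,
      ← Finset.sum_sub_distrib]
    refine Finset.sum_le_sum fun j _ => ?_
    have := mul_le_mul_of_nonneg_left (hm (x j)) (a.nonneg (i - 2 • j))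
    linarith
  have hcont : Continuous (a.energy x i) := by
    rw [show a.energy x i = _ from funext hE]
    fun_prop
  have hnn : ∀ p, 0 ≤ a.energy x i p := fun p => by
    rw [hE]
    exact Finset.sum_nonneg fun j _ => mul_nonneg (a.nonneg _) (sq_nonneg _)
  have hbdd : BddBelow (Set.range (a.energy x i)) := ⟨0, by rintro _ ⟨p, rfl⟩; exact hnn p⟩
  have : Nonempty X := ⟨x 0⟩
  set I := ⨅ p, a.energy x i p with hI
  have hIle : ∀ p, I ≤ a.energy x i p := fun p => ciInf_le hbdd p
  have hdist : ∀ p q, dist p q ^ 2 ≤ 2 * (a.energy x i p - I) + 2 * (a.energy x i q - I) := by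
    intro p q
    obtain ⟨m, hm⟩ := hmid p q
    linarith [hIle m]
  have hex : ∀ n : ℕ, ∃ p, a.energy x i p < I + 1 / ((n : ℝ) + 1) := fun n =>
    exists_lt_of_ciInf_lt (lt_add_of_pos_right I Nat.one_div_pos_of_nat)
  choose u hu using hex
  have hlim : Tendsto (fun n : ℕ => 1 / ((n : ℝ) + 1)) atTop (𝓝 0) :=
    tendsto_one_div_add_atTop_nhds_zero_nat
  have hcau : CauchySeq u := by
    refine cauchySeq_of_le_tendsto_0 (fun n : ℕ => Real.sqrt (4 * (1 / ((n : ℝ) + 1)))) ?_ ?_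
    · intro n m N hn hm
      apply Real.le_sqrt_of_sq_le
      have h1 : 1 / ((n : ℝ) + 1) ≤ 1 / ((N : ℝ) + 1) := Nat.one_div_le_one_div hn
      have h2 : 1 / ((m : ℝ) + 1) ≤ 1 / ((N : ℝ) + 1) := Nat.one_div_le_one_div hm
      linarith [hdist (u n) (u m), hu n, hu m]
    · have := (Real.continuous_sqrt.tendsto _).comp (hlim.const_mul 4)
      simpa [Function.comp_def] using this
  obtain ⟨p, hp⟩ := cauchySeq_tendsto_of_complete hcau
  have hpI : a.energy x i p ≤ I := by
    have h1 := (hcont.tendsto p).comp hp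
    have h2 : Tendsto (fun n : ℕ => I + 1 / ((n : ℝ) + 1)) atTop (𝓝 I) := by
      simpa using hlim.const_add I
    exact le_of_tendsto_of_tendsto' h1 h2 fun n => (hu n).le
  refine ⟨p, fun q => hpI.trans (hIle q), fun q hq => ?_⟩
  have h1 := hdist q p
  have h2 := hq p
  have h3 : dist q p ^ 2 ≤ 0 := by linarith
  exact dist_eq_zero.1 (pow_eq_zero_iff two_ne_zero |>.1 (le_antisymm h3 (sq_nonneg _)))

/-- The barycentric rule `(Sx)_i = argmin ∑_j a_{i-2j} d²(x_j, ·)`. -/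
noncomputable def barycenter {X : Type*} [MetricSpace X] [IsHadamard X]
    (x : (Fin s → ℤ) → X) (i : Fin s → ℤ) : X :=
  (a.existsUnique_minimizer x i).exists.choose

lemma barycenter_spec {X : Type*} [MetricSpace X] [IsHadamard X]
    (x : (Fin s → ℤ) → X) (i : Fin s → ℤ) (q : X) :
    a.energy x i (a.barycenter x i) ≤ a.energy x i q :=
  (a.existsUnique_minimizer x i).exists.choose_spec q

lemma isBounded_barycenter {X : Type*} [MetricSpace X] [IsHadamard X]
    {x : (Fin s → ℤ) → X} (hx : Bornology.IsBounded (Set.range x)) :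
    Bornology.IsBounded (Set.range (a.barycenter x)) := by
  obtain ⟨B, hB⟩ := Metric.isBounded_range_iff.1 hx
  have hB0 : 0 ≤ B := dist_nonneg.trans (hB 0 0)
  refine (Metric.isBounded_iff_subset_closedBall (x 0)).2 ⟨2 * B, ?_⟩
  rintro _ ⟨i, rfl⟩
  rw [Metric.mem_closedBall]
  set p := a.barycenter x i with hp
  have hE : ∀ p, a.energy x i p =
      ∑ j ∈ (a.finite_weights i).toFinset, a.coeff (i - 2 • j) * dist (x j) p ^ 2 :=
    fun p => a.finsum_eq i _
  have hmin : a.energy x i p ≤ a.energy x i (x 0) := a.barycenter_spec x i (x 0)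
  have hsum : ∀ c : ℝ, ∑ j ∈ (a.finite_weights i).toFinset, a.coeff (i - 2 • j) * c = c :=
    fun c => by rw [← Finset.sum_mul, a.sum_weights, one_mul]
  have h0 : a.energy x i (x 0) ≤ B ^ 2 := by
    rw [hE, ← hsum (B ^ 2)]
    refine Finset.sum_le_sum fun j _ => mul_le_mul_of_nonneg_left ?_ (a.nonneg _)
    exact pow_le_pow_left₀ dist_nonneg (hB j 0) 2
  have h1 : dist p (x 0) ^ 2 ≤ 2 * B ^ 2 + 2 * a.energy x i p := by
    rw [hE, ← hsum (dist p (x 0) ^ 2), ← hsum (2 * B ^ 2), Finset.mul_sum,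
      ← Finset.sum_add_distrib]
    refine Finset.sum_le_sum fun j _ => ?_
    have h2 : dist p (x 0) ≤ dist (x j) p + B :=
      (dist_triangle_left p (x 0) (x j)).trans (by linarith [hB j 0])
    have h3 : dist p (x 0) ^ 2 ≤ 2 * B ^ 2 + 2 * dist (x j) p ^ 2 := by
      have := pow_le_pow_left₀ dist_nonneg h2 2
      nlinarith [sq_nonneg (dist (x j) p - B)]
    have := mul_le_mul_of_nonneg_left h3 (a.nonneg (i - 2 • j))
    linarith
  exact abs_le_of_sq_le_sq' (by nlinarith) (by linarith) |>.2

/-- The barycentric refinement scheme with mask `a` on a Hadamard space `X`. -/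
noncomputable def barycentricScheme (X : Type*) [MetricSpace X] [IsHadamard X] :
    RefinementScheme s X :=
  fun x => ⟨a.barycenter x, a.isBounded_barycenter x.2⟩

lemma isBounded_linear {x : (Fin s → ℤ) → ℝ} (hx : Bornology.IsBounded (Set.range x)) :
    Bornology.IsBounded
      (Set.range fun i : Fin s → ℤ => ∑ᶠ j : Fin s → ℤ, a.coeff (i - 2 • j) * x j) := by
  obtain ⟨B, hB⟩ := hx.exists_norm_le
  refine (Metric.isBounded_iff_subset_closedBall 0).2 ⟨B, ?_⟩
  rintro _ ⟨i, rfl⟩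
  rw [mem_closedBall_zero_iff]
  beta_reduce
  rw [a.finsum_eq]
  calc _ ≤ ∑ j ∈ (a.finite_weights i).toFinset, a.coeff (i - 2 • j) * B := by
        refine norm_sum_le_of_le _ fun j _ => ?_
        rw [norm_mul, Real.norm_of_nonneg (a.nonneg _)]
        exact mul_le_mul_of_nonneg_left (hB _ ⟨j, rfl⟩) (a.nonneg _)
    _ = B := by rw [← Finset.sum_mul, a.sum_weights, one_mul]

/-- The linear scheme `(Sx)_i = ∑_j a_{i-2j} x_j` on real-valued data. -/
noncomputable def linearScheme : RefinementScheme s ℝ :=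
  fun x => ⟨fun i => ∑ᶠ j : Fin s → ℤ, a.coeff (i - 2 • j) * x j, a.isBounded_linear x.2⟩

end Mask

/-! On the real line the barycenter is the weighted mean (`barycenter_eq_op`), so (2) and (3)
concern the same scheme. The substance is (3) → (1): scalar convergence must control every Hadamard
space. Write T for `op`. The variance inequality yields Jensen's inequality for squared distances,
and it iterates: d²((Sⁿx)_i, q) is at most row i of Tⁿ applied to d²(x, q)
(`dist_iterate_sq_le_op_pow`). Applied twice, it bounds d² between two values of Sⁿx by averaging
d²(x_k, x_l) over independent k and l drawn from two rows of Tⁿ. Convergence of the linear scheme on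
δ₀ forces nearby rows of some Tⁿ to share an entry of size at least c (`exists_overlap`). The
diagonal pair at that entry costs nothing, so local squared oscillation shrinks by the factor 1 - c²
(`OscLE.contract`). Vanishing oscillation makes the sampled iterates uniformly Cauchy, with a
continuous limit. -/

namespace Mask

variable {s : ℕ} (a : Mask s)

/-! ### The linear operator: locality and shift covariance -/

/-- The linear operator `(Tu)_i = ∑_j a_{i-2j} u_j` on arbitrary real sequences. -/
noncomputable def op : Module.End ℝ ((Fin s → ℤ) → ℝ) where
  toFun u i := ∑ j ∈ (a.finite_weights i).toFinset, a.coeff (i - 2 • j) * u j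
  map_add' u v := by
    funext i
    simp [mul_add, Finset.sum_add_distrib]
  map_smul' c u := by
    funext i
    simp [Finset.mul_sum, mul_left_comm]

lemma op_apply (u : (Fin s → ℤ) → ℝ) (i : Fin s → ℤ) :
    a.op u i = ∑ j ∈ (a.finite_weights i).toFinset, a.coeff (i - 2 • j) * u j := rfl

lemma op_eq_finsum (u : (Fin s → ℤ) → ℝ) (i : Fin s → ℤ) :
    a.op u i = ∑ᶠ j, a.coeff (i - 2 • j) * u j := (a.finsum_eq i u).symm

lemma op_const (c : ℝ) : a.op (fun _ => c) = fun _ => c := by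
  funext i
  rw [op_apply, ← Finset.sum_mul, a.sum_weights, one_mul]

lemma op_pow_const (n : ℕ) (c : ℝ) : (a.op ^ n) (fun _ => c) = fun _ => c := by
  induction n with
  | zero => rfl
  | succ n ih => rw [pow_succ, Module.End.mul_apply, op_const, ih]

lemma op_le_op {u v : (Fin s → ℤ) → ℝ} {i : Fin s → ℤ}
    (h : ∀ j, a.coeff (i - 2 • j) ≠ 0 → u j ≤ v j) : a.op u i ≤ a.op v i :=
  Finset.sum_le_sum fun j hj => mul_le_mul_of_nonneg_left (h j (by simpa using hj)) (a.nonneg _)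

lemma exists_radius : ∃ R : ℤ, 1 ≤ R ∧ ∀ i, a.coeff i ≠ 0 → ∀ t, |i t| ≤ R := by
  refine ⟨1 + ∑ i ∈ a.finite_support.toFinset, ∑ t, |i t|, ?_, fun i hi t => ?_⟩
  · exact le_add_of_nonneg_right
      (Finset.sum_nonneg fun i _ => Finset.sum_nonneg fun t _ => abs_nonneg _)
  · have h1 : |i t| ≤ ∑ t, |i t| :=
      Finset.single_le_sum (f := fun t => |i t|) (fun t _ => abs_nonneg _) (Finset.mem_univ t)
    have h2 : ∑ t, |i t| ≤ ∑ i ∈ a.finite_support.toFinset, ∑ t, |i t| :=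
      Finset.single_le_sum (f := fun i : Fin s → ℤ => ∑ t, |i t|)
        (fun i _ => Finset.sum_nonneg fun t _ => abs_nonneg _) (by simpa using hi)
    linarith

/-- `(T^n u)_i` depends monotonically on the values `u_k` with `|i - 2^n k| ≤ (2^n - 1) R`. -/
lemma op_pow_le_op_pow {R : ℤ} (hR : ∀ i, a.coeff i ≠ 0 → ∀ t, |i t| ≤ R)
    {u v : (Fin s → ℤ) → ℝ} (n : ℕ) (i : Fin s → ℤ)
    (h : ∀ k, (∀ t, |i t - 2 ^ n * k t| ≤ (2 ^ n - 1) * R) → u k ≤ v k) :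
    (a.op ^ n) u i ≤ (a.op ^ n) v i := by
  induction n generalizing i with
  | zero =>
    refine h i fun t => ?_
    simp
  | succ n ih =>
    rw [pow_succ', Module.End.mul_apply, Module.End.mul_apply]
    refine a.op_le_op fun j hj => ih j fun k hk => h k fun t => ?_
    have h1 := hR _ hj t
    have h2 := hk t
    rw [Pi.sub_apply, Pi.smul_apply, nsmul_eq_mul, Nat.cast_ofNat] at h1
    rw [abs_le] at h1 h2 ⊢
    rw [pow_succ]
    constructor <;> nlinarith

lemma op_pow_mono (n : ℕ) {u v : (Fin s → ℤ) → ℝ} (h : u ≤ v) : (a.op ^ n) u ≤ (a.op ^ n) v := by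
  obtain ⟨R, -, hR⟩ := a.exists_radius
  exact fun i => a.op_pow_le_op_pow hR n i fun k _ => h k

lemma op_shift (u : (Fin s → ℤ) → ℝ) (k : Fin s → ℤ) :
    a.op (fun j => u (j - k)) = fun i => a.op u (i - 2 • k) := by
  funext i
  rw [op_eq_finsum, op_eq_finsum]
  refine (finsum_comp_equiv (Equiv.addRight k)).symm.trans (finsum_congr fun j => ?_)
  simp only [Equiv.coe_addRight, add_sub_cancel_right]
  congr 2
  rw [smul_add]
  abel

lemma op_pow_shift (n : ℕ) (u : (Fin s → ℤ) → ℝ) (k : Fin s → ℤ) :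
    (a.op ^ n) (fun j => u (j - k)) = fun i => (a.op ^ n) u (i - 2 ^ n • k) := by
  induction n with
  | zero => simp
  | succ n ih =>
    funext i
    rw [pow_succ', Module.End.mul_apply, ih, Module.End.mul_apply, pow_succ, mul_smul]
    have := congrFun (a.op_shift ((a.op ^ n) u) (2 ^ n • k)) i
    rw [this, smul_comm]

/-! ### Iterated masks and overlapping rows -/

/-- The `n`-th iterated mask `T^n δ_0`. -/
noncomputable def iterMask (n : ℕ) : (Fin s → ℤ) → ℝ := (a.op ^ n) (Pi.single 0 1)

lemma op_pow_single (n : ℕ) (k i : Fin s → ℤ) :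
    (a.op ^ n) (Pi.single k 1) i = a.iterMask n (i - 2 ^ n • k) := by
  have h : (Pi.single k 1 : (Fin s → ℤ) → ℝ) =
      fun j => (Pi.single 0 1 : (Fin s → ℤ) → ℝ) (j - k) := by
    funext j
    simp [Pi.single_apply, sub_eq_zero]
  rw [h, op_pow_shift, iterMask]

/-- In every row of `T^n`, some entry near the expected position is bounded below by a constant
independent of `n`. -/
lemma exists_le_iterMask {R : ℤ} (hR1 : 1 ≤ R)
    (hR : ∀ i, a.coeff i ≠ 0 → ∀ t, |i t| ≤ R) :
    ∃ c : ℝ, 0 < c ∧ ∀ n i, ∃ k : Fin s → ℤ,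
      (∀ t, |i t - 2 ^ n * k t| ≤ 2 ^ n * (R + 2)) ∧ c ≤ a.iterMask n (i - 2 ^ n • k) := by
  classical
  set F : Finset (Fin s → ℤ) := Finset.Icc (fun _ => -(R + 1)) (fun _ => R + 1) with hF
  -- Pigeonhole: a row has total mass 1 and is supported in `k₀ + F`, whose size does not depend on
  -- `n`.
  refine ⟨1 / (F.card + 1), by positivity, fun n i => ?_⟩
  have hpow : (0 : ℤ) < 2 ^ n := by positivity
  set k₀ : Fin s → ℤ := fun t => i t / 2 ^ n with hk₀
  have hk : ∀ t, 2 ^ n * k₀ t ≤ i t ∧ i t < 2 ^ n * k₀ t + 2 ^ n := fun t =>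
    ⟨Int.mul_ediv_self_le hpow.ne', Int.lt_mul_ediv_self_add hpow⟩
  by_contra! hcon
  have h1 : (a.op ^ n) (fun _ => 1) i ≤ (a.op ^ n) (∑ e ∈ F, Pi.single (k₀ + e) 1) i := by
    refine a.op_pow_le_op_pow hR n i fun k hk' => ?_
    have hmem : k - k₀ ∈ F := by
      rw [hF, Finset.mem_Icc]
      constructor <;> intro t <;> have h2 := abs_le.1 (hk' t) <;> obtain ⟨h3, h4⟩ := hk t <;>
        simp only [Pi.sub_apply]
      · by_contra! h5
        have h6 : k t + R + 2 ≤ k₀ t := by linarith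
        have := mul_le_mul_of_nonneg_left h6 hpow.le
        nlinarith
      · by_contra! h5
        have h6 : k₀ t + R + 2 ≤ k t := by linarith
        have := mul_le_mul_of_nonneg_left h6 hpow.le
        nlinarith
    rw [Finset.sum_apply]
    have h0 : ∀ e ∈ F, (0 : ℝ) ≤ (Pi.single (k₀ + e) 1 : (Fin s → ℤ) → ℝ) k := by
      intro e _
      rw [Pi.single_apply]
      split_ifs <;> norm_num
    refine le_trans ?_ (Finset.single_le_sum h0 hmem)
    simp
  rw [op_pow_const, map_sum, Finset.sum_apply] at h1
  have h2 : ∑ e ∈ F, (a.op ^ n) (Pi.single (k₀ + e) 1) i ≤ ∑ e ∈ F, (1 / (F.card + 1) : ℝ) := by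
    refine Finset.sum_le_sum fun e he => ?_
    rw [op_pow_single]
    refine (hcon (k₀ + e) fun t => ?_).le
    rw [hF, Finset.mem_Icc] at he
    have h3 := he.1 t
    have h4 := he.2 t
    obtain ⟨h5, h6⟩ := hk t
    have h7 := mul_le_mul_of_nonneg_left h3 hpow.le
    have h8 := mul_le_mul_of_nonneg_left h4 hpow.le
    rw [abs_le, Pi.add_apply]
    constructor <;> nlinarith
  rw [Finset.sum_const, nsmul_eq_mul, mul_one_div] at h2
  have h3 : (F.card : ℝ) / (F.card + 1) < 1 := by
    rw [div_lt_one (by positivity)]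
    linarith
  linarith

lemma coe_linearScheme_iterate (n : ℕ) (x : BoundedSeq s ℝ) :
    ((a.linearScheme^[n] x : BoundedSeq s ℝ) : (Fin s → ℤ) → ℝ) = (a.op ^ n) x := by
  induction n with
  | zero => rfl
  | succ n ih =>
    rw [Function.iterate_succ_apply', pow_succ', Module.End.mul_apply, ← ih]
    funext i
    exact (a.op_eq_finsum _ i).symm

/-- If the linear scheme converges, the rows of some power of `T` with nearby indices overlap. -/
lemma exists_overlap (h : a.linearScheme.Convergent) {R : ℤ} (hR1 : 1 ≤ R)
    (hR : ∀ i, a.coeff i ≠ 0 → ∀ t, |i t| ≤ R) (C : ℤ) :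
    ∃ c : ℝ, 0 < c ∧ ∃ n, ∀ i i' : Fin s → ℤ, (∀ t, |i t - i' t| ≤ C) →
      ∃ k : Fin s → ℤ, c ≤ (a.op ^ n) (Pi.single k 1) i ∧ c ≤ (a.op ^ n) (Pi.single k 1) i' := by
  obtain ⟨c, hc, hrow⟩ := a.exists_le_iterMask hR1 hR
  have hb : Bornology.IsBounded (Set.range (Pi.single 0 1 : (Fin s → ℤ) → ℝ)) := by
    refine (Metric.isBounded_iff_subset_closedBall 0).2 ⟨1, ?_⟩
    rintro _ ⟨i, rfl⟩
    rw [mem_closedBall_zero_iff, Pi.single_apply]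
    split_ifs <;> simp
  obtain ⟨f, hf, hlim⟩ := h ⟨Pi.single 0 1, hb⟩
  -- By shift covariance every row entry is a value of the single sequence `iterMask n`. The
  -- relevant positions, divided by 2ⁿ, stay in this fixed ball, so one modulus of continuity of `f`
  -- serves all rows.
  set K : Set (Fin s → ℝ) := Metric.closedBall 0 (|(R : ℝ) + 2| + |(C : ℝ)|)
  have huc := (isCompact_closedBall _ _ : IsCompact K).uniformContinuousOn_of_continuous
    hf.continuousOn
  obtain ⟨δ, hδ, hfδ⟩ := Metric.uniformContinuousOn_iff.1 huc (c / 4) (by linarith)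
  have hsmall : ∀ᶠ n : ℕ in atTop, |(C : ℝ)| / 2 ^ n < δ := by
    have := (tendsto_pow_atTop_atTop_of_one_lt (one_lt_two (α := ℝ))).const_div_atTop |(C : ℝ)|
    exact this.eventually_lt_const hδ
  have hε : ENNReal.ofReal (c / 8) > 0 := by simpa using hc
  obtain ⟨n, hn1, hn2⟩ := (hsmall.and (hlim.eventually_lt_const hε)).exists
  have hpow : (0 : ℝ) < 2 ^ n := by positivity
  have happ : ∀ j : Fin s → ℤ, |f (fun t => (j t : ℝ) / 2 ^ n) - a.iterMask n j| < c / 8 := by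
    intro j
    have h1 := (le_iSup (fun j : Fin s → ℤ => edist (f (fun k => (j k : ℝ) / 2 ^ n))
      ((a.linearScheme^[n] ⟨Pi.single 0 1, hb⟩) j)) j).trans_lt hn2
    have h2 := congrFun (a.coe_linearScheme_iterate n ⟨Pi.single 0 1, hb⟩) j
    rw [edist_lt_ofReal, h2] at h1
    exact h1
  -- The loss from `c` is c/4 from continuity plus twice c/8 from approximation.
  refine ⟨c / 2, by linarith, n, fun i i' hii => ?_⟩
  obtain ⟨k, hk, hck⟩ := hrow n i
  refine ⟨k, ?_, ?_⟩
  · rw [op_pow_single]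
    linarith
  · rw [op_pow_single]
    set p := i - 2 ^ n • k with hp
    set p' := i' - 2 ^ n • k with hp'
    have hpp : ∀ t, |(p' t : ℝ) - p t| ≤ |(C : ℝ)| := fun t => by
      have h1 : |p' t - p t| ≤ C := by
        have := hii t
        rw [abs_sub_comm] at this
        simpa [hp, hp'] using this
      exact (by exact_mod_cast h1 : |(p' t : ℝ) - p t| ≤ (C : ℝ)).trans (le_abs_self _)
    have hpb : ∀ t, |(p t : ℝ)| ≤ 2 ^ n * |(R : ℝ) + 2| := fun t => by
      have h1 : |p t| ≤ 2 ^ n * (R + 2) := by simpa [hp] using hk t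
      have h2 : |(p t : ℝ)| ≤ 2 ^ n * ((R : ℝ) + 2) := by exact_mod_cast h1
      exact h2.trans (mul_le_mul_of_nonneg_left (le_abs_self _) hpow.le)
    have hone : (1 : ℝ) ≤ 2 ^ n := one_le_pow₀ one_le_two
    have hC0 := abs_nonneg (C : ℝ)
    have m1 : (fun t => (p t : ℝ) / 2 ^ n) ∈ K := by
      rw [mem_closedBall_zero_iff, pi_norm_le_iff_of_nonneg (by positivity)]
      intro t
      rw [Real.norm_eq_abs, abs_div, abs_of_pos hpow, div_le_iff₀ hpow]
      nlinarith [hpb t]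
    have m2 : (fun t => (p' t : ℝ) / 2 ^ n) ∈ K := by
      rw [mem_closedBall_zero_iff, pi_norm_le_iff_of_nonneg (by positivity)]
      intro t
      rw [Real.norm_eq_abs, abs_div, abs_of_pos hpow, div_le_iff₀ hpow]
      have h3 : |(p' t : ℝ)| ≤ |(p t : ℝ)| + |(C : ℝ)| := by
        have := abs_add_le (p t : ℝ) (p' t - p t)
        rw [add_sub_cancel] at this
        linarith [hpp t]
      nlinarith [hpb t]
    have hd : dist (fun t => (p' t : ℝ) / 2 ^ n) (fun t => (p t : ℝ) / 2 ^ n) < δ := by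
      refine lt_of_le_of_lt ((dist_pi_le_iff (by positivity)).2 fun t => ?_) hn1
      rw [Real.dist_eq, ← sub_div, abs_div, abs_of_pos hpow]
      exact div_le_div_of_nonneg_right (hpp t) hpow.le
    have h4 := abs_lt.1 (Real.dist_eq _ _ ▸ hfδ _ m2 _ m1 hd)
    have h5 := abs_lt.1 (happ p)
    have h6 := abs_lt.1 (happ p')
    linarith

/-! ### Variance and Jensen inequalities in Hadamard spaces -/

lemma energy_eq_op {X : Type*} [MetricSpace X] (x : (Fin s → ℤ) → X) (i : Fin s → ℤ) (p : X) :
    a.energy x i p = a.op (fun j => dist (x j) p ^ 2) i :=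
  (a.op_eq_finsum _ i).symm

section Hadamard

variable {X : Type*} [MetricSpace X] [IsHadamard X]

/-- The variance inequality for weighted barycenters. -/
lemma dist_barycenter_sq_le (x : (Fin s → ℤ) → X) (i : Fin s → ℤ) (q : X) :
    dist (a.barycenter x i) q ^ 2 ≤ a.energy x i q - a.energy x i (a.barycenter x i) := by
  set p := a.barycenter x i with hp
  have hmid : ∀ q, ∃ m, 1 / 4 * dist p q ^ 2 ≤ dist p m ^ 2 ∧ a.energy x i m ≤
      1 / 2 * a.energy x i p + 1 / 2 * a.energy x i q - 1 / 4 * dist p q ^ 2 := by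
    intro q
    obtain ⟨m, hm⟩ := IsHadamard.exists_midpoint p q
    refine ⟨m, ?_, ?_⟩
    · have h1 := hm q
      rw [dist_self, dist_comm q p] at h1
      have h2 : dist q m ≤ 1 / 2 * dist p q :=
        (abs_le_of_sq_le_sq' (by nlinarith) (by positivity)).2
      have h3 : 1 / 2 * dist p q ≤ dist p m := by
        have := dist_triangle_right p q m
        linarith
      have := pow_le_pow_left₀ (by positivity) h3 2
      linarith
    · have h1 : a.energy x i m ≤ a.op ((1 / 2 : ℝ) • (fun j => dist (x j) p ^ 2) +
          (1 / 2 : ℝ) • (fun j => dist (x j) q ^ 2) - fun _ => 1 / 4 * dist p q ^ 2) i := by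
        rw [energy_eq_op]
        exact a.op_le_op fun j _ => hm (x j)
      rw [map_sub, map_add, map_smul, map_smul, op_const] at h1
      simpa [energy_eq_op] using h1
  -- Minimality gives constant 0. Applying the bound at the midpoint improves a constant κ to (1 +
  -- κ)/2, so the constants tend to the sharp value 1, which lets Jensen's inequality iterate
  -- without loss.
  have hiter : ∀ n : ℕ, ∀ q, (1 - (1 / 2) ^ n) * dist p q ^ 2 ≤ a.energy x i q - a.energy x i p := by
    intro n
    induction n with
    | zero =>
      intro q
      simpa using a.barycenter_spec x i q
    | succ n ih =>
      intro q
      obtain ⟨m, hm1, hm2⟩ := hmid q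
      have h1 := ih m
      have h2 : (0 : ℝ) ≤ 1 - (1 / 2) ^ n := by
        have : ((1 : ℝ) / 2) ^ n ≤ 1 := pow_le_one₀ (by norm_num) (by norm_num)
        linarith
      have h3 := mul_le_mul_of_nonneg_left hm1 h2
      rw [pow_succ]
      nlinarith
  have hlim : Tendsto (fun n : ℕ => (1 - ((1 : ℝ) / 2) ^ n) * dist p q ^ 2) atTop
      (𝓝 ((1 - 0) * dist p q ^ 2)) :=
    ((tendsto_pow_atTop_nhds_zero_of_lt_one (by norm_num) (by norm_num)).const_sub 1).mul_const _
  rw [sub_zero, one_mul] at hlim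
  exact le_of_tendsto' hlim fun n => hiter n q

lemma dist_barycenter_sq_le_op (x : (Fin s → ℤ) → X) (i : Fin s → ℤ) (q : X) :
    dist (a.barycenter x i) q ^ 2 ≤ a.op (fun j => dist (x j) q ^ 2) i := by
  have h1 := a.dist_barycenter_sq_le x i q
  have h2 : 0 ≤ a.energy x i (a.barycenter x i) := finsum_nonneg fun j =>
    mul_nonneg (a.nonneg _) (sq_nonneg _)
  rw [← energy_eq_op]
  linarith

lemma dist_iterate_sq_le_op_pow (n : ℕ) (x : (Fin s → ℤ) → X) (i : Fin s → ℤ) (q : X) :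
    dist (a.barycenter^[n] x i) q ^ 2 ≤ (a.op ^ n) (fun j => dist (x j) q ^ 2) i := by
  induction n generalizing i with
  | zero => exact le_rfl
  | succ n ih =>
    rw [Function.iterate_succ_apply', pow_succ' a.op, Module.End.mul_apply]
    exact (a.dist_barycenter_sq_le_op _ i q).trans (a.op_le_op fun j _ => ih j)

/-- Jensen's inequality is used first with the point (Sⁿx)_{i'}, then with each x_k; the result is
an average over the product of the two rows. -/
lemma dist_iterate_iterate_sq_le (n : ℕ) (x : (Fin s → ℤ) → X) (i i' : Fin s → ℤ) :
    dist (a.barycenter^[n] x i) (a.barycenter^[n] x i') ^ 2 ≤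
      (a.op ^ n) (fun k => (a.op ^ n) (fun l => dist (x k) (x l) ^ 2) i') i := by
  refine (a.dist_iterate_sq_le_op_pow n x i _).trans (a.op_pow_mono n (fun k => ?_) i)
  have := a.dist_iterate_sq_le_op_pow n x i' (x k)
  rw [dist_comm]
  simpa only [dist_comm] using this

/-! ### Contraction of the oscillation -/

/-- `B` bounds the squared distances of values of `y` at indices at most `C` apart. -/
def OscLE (C : ℤ) (y : (Fin s → ℤ) → X) (B : ℝ) : Prop :=
  ∀ k l : Fin s → ℤ, (∀ t, |k t - l t| ≤ C) → dist (y k) (y l) ^ 2 ≤ B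

/-- The width 2R is self-reproducing: 2R + 2(2ⁿ - 1)R = 2ⁿ · 2R. -/
lemma abs_sub_le_of_near {R : ℤ} {n : ℕ} {i i' k l : ℤ} (h : |i - i'| ≤ 2 * R)
    (hk : |i - 2 ^ n * k| ≤ (2 ^ n - 1) * R) (hl : |i' - 2 ^ n * l| ≤ (2 ^ n - 1) * R) :
    |k - l| ≤ 2 * R := by
  have hpow : (0 : ℤ) < 2 ^ n := by positivity
  rw [abs_le] at *
  constructor
  · refine le_of_mul_le_mul_left ?_ hpow
    nlinarith
  · refine le_of_mul_le_mul_left ?_ hpow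
    nlinarith

lemma OscLE.iterate {R : ℤ} (hR : ∀ i, a.coeff i ≠ 0 → ∀ t, |i t| ≤ R)
    {y : (Fin s → ℤ) → X} {B : ℝ} (hy : OscLE (2 * R) y B) (n : ℕ) :
    OscLE (2 * R) (a.barycenter^[n] y) B := by
  intro i i' hii
  refine (a.dist_iterate_iterate_sq_le n y i i').trans ?_
  refine (a.op_pow_le_op_pow hR n i (v := fun _ => B) fun k hk => ?_).trans_eq
    (congrFun (a.op_pow_const n B) i)
  refine (a.op_pow_le_op_pow hR n i' (v := fun _ => B) fun l hl => ?_).trans_eq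
    (congrFun (a.op_pow_const n B) i')
  exact hy k l fun t => abs_sub_le_of_near (hii t) (hk t) (hl t)

/-- In the product of the two rows, the pair (j, j) has weight at least c² and distance zero; all
other contributing pairs are bounded by `B`. -/
lemma OscLE.contract {R : ℤ} (hR : ∀ i, a.coeff i ≠ 0 → ∀ t, |i t| ≤ R) {c : ℝ} (hc : 0 ≤ c)
    {n : ℕ} (hov : ∀ i i' : Fin s → ℤ, (∀ t, |i t - i' t| ≤ 2 * R) →
      ∃ k : Fin s → ℤ, c ≤ (a.op ^ n) (Pi.single k 1) i ∧ c ≤ (a.op ^ n) (Pi.single k 1) i')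
    {y : (Fin s → ℤ) → X} {B : ℝ} (hB : 0 ≤ B) (hy : OscLE (2 * R) y B) :
    OscLE (2 * R) (a.barycenter^[n] y) ((1 - c ^ 2) * B) := by
  intro i i' hii
  obtain ⟨j, hj, hj'⟩ := hov i i' hii
  have hin : ∀ e, (a.op ^ n) ((fun _ => B) - e • Pi.single j 1) =
      (fun _ => B) - e • (a.op ^ n) (Pi.single j 1) := fun e => by
    rw [map_sub, map_smul, op_pow_const]
  refine (a.dist_iterate_iterate_sq_le n y i i').trans ?_
  refine (a.op_pow_le_op_pow hR n i (v := (fun _ => B) - (c * B) • Pi.single j 1)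
    fun k hk => ?_).trans ?_
  · refine (a.op_pow_le_op_pow hR n i' (v := (fun _ => B) -
      (B * (Pi.single j 1 : (Fin s → ℤ) → ℝ) k) • Pi.single j 1) fun l hl => ?_).trans ?_
    · by_cases hkl : k = j ∧ l = j
      · obtain ⟨rfl, rfl⟩ := hkl
        simp
      · have h1 : B * (Pi.single j 1 : (Fin s → ℤ) → ℝ) k *
            (Pi.single j 1 : (Fin s → ℤ) → ℝ) l = 0 := by
          rw [Pi.single_apply, Pi.single_apply]
          rw [not_and_or] at hkl
          rcases hkl with h | h <;> simp [h]
        simp only [Pi.sub_apply, Pi.smul_apply, smul_eq_mul, h1, sub_zero]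
        exact hy k l fun t => abs_sub_le_of_near (hii t) (hk t) (hl t)
    · rw [hin]
      have h0 : 0 ≤ B * (Pi.single j 1 : (Fin s → ℤ) → ℝ) k := by
        rw [Pi.single_apply]
        split_ifs <;> simp [hB]
      have := mul_le_mul_of_nonneg_left hj' h0
      simp only [Pi.sub_apply, Pi.smul_apply, smul_eq_mul]
      linarith
  · rw [hin]
    have := mul_le_mul_of_nonneg_left hj (mul_nonneg hc hB)
    simp only [Pi.sub_apply, Pi.smul_apply, smul_eq_mul]
    linarith

/-- The oscillation of the iterates tends to zero when the linear scheme converges. -/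
lemma exists_oscLE_iterate (h : a.linearScheme.Convergent) {R : ℤ} (hR1 : 1 ≤ R)
    (hR : ∀ i, a.coeff i ≠ 0 → ∀ t, |i t| ≤ R) {x : (Fin s → ℤ) → X}
    (hx : Bornology.IsBounded (Set.range x)) {ε : ℝ} (hε : 0 < ε) :
    ∃ n₀, ∀ n, n₀ ≤ n → OscLE (2 * R) (a.barycenter^[n] x) ε := by
  obtain ⟨c, hc, N, hov⟩ := a.exists_overlap h hR1 hR (2 * R)
  obtain ⟨B, hB⟩ := Metric.isBounded_range_iff.1 hx
  -- Truncation keeps the contraction factor 1 - d² in [0, 1).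
  set d := min c 1
  have hd : 0 < d := lt_min hc one_pos
  have hd1 : d ≤ 1 := min_le_right _ _
  have hq0 : 0 ≤ 1 - d ^ 2 := by nlinarith
  have hq1 : 1 - d ^ 2 < 1 := by nlinarith
  have hosc : ∀ m : ℕ, OscLE (2 * R) (a.barycenter^[N * m] x) ((1 - d ^ 2) ^ m * B ^ 2) := by
    intro m
    induction m with
    | zero =>
      intro k l _
      simpa using pow_le_pow_left₀ dist_nonneg (hB k l) 2
    | succ m ih =>
      rw [Nat.mul_succ, Nat.add_comm, Function.iterate_add_apply, pow_succ', mul_assoc]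
      refine OscLE.contract a hR hd.le (fun i i' hii => ?_) (by positivity) ih
      obtain ⟨k, h1, h2⟩ := hov i i' hii
      exact ⟨k, (min_le_left _ _).trans h1, (min_le_left _ _).trans h2⟩
  have hlim : Tendsto (fun m : ℕ => (1 - d ^ 2) ^ m * B ^ 2) atTop (𝓝 (0 * B ^ 2)) :=
    (tendsto_pow_atTop_nhds_zero_of_lt_one hq0 hq1).mul_const _
  rw [zero_mul] at hlim
  obtain ⟨m, hm⟩ := (hlim.eventually_lt_const hε).exists
  refine ⟨N * m, fun n hn => ?_⟩
  obtain ⟨r, rfl⟩ := Nat.exists_eq_add_of_le hn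
  rw [Nat.add_comm, Function.iterate_add_apply]
  exact OscLE.iterate a hR (fun k l hkl => (hosc m k l hkl).trans hm.le) r

/-! ### Dyadic sampling and the limit function -/

/-- The multi-index `⌊2^n t⌋`. -/
noncomputable def dyadicFloor (n : ℕ) (p : Fin s → ℝ) : Fin s → ℤ := fun t => ⌊2 ^ n * p t⌋

lemma abs_dyadicFloor_sub_le (n m : ℕ) (p : Fin s → ℝ) (t : Fin s) :
    |dyadicFloor (m + n) p t - 2 ^ m * dyadicFloor n p t| ≤ 2 ^ m := by
  have hpow : (0 : ℝ) < 2 ^ m := by positivity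
  have h1 := Int.floor_le (2 ^ n * p t)
  have h2 := Int.lt_floor_add_one (2 ^ n * p t)
  have h3 := Int.floor_le (2 ^ (m + n) * p t)
  have h4 := Int.lt_floor_add_one (2 ^ (m + n) * p t)
  have h5 := mul_le_mul_of_nonneg_left h1 hpow.le
  have h6 := mul_le_mul_of_nonneg_left h2.le hpow.le
  rw [pow_add, mul_assoc] at h3 h4
  unfold dyadicFloor
  rw [pow_add, mul_assoc]
  rw [abs_le]
  constructor
  · have h7 : (2 ^ m * ⌊2 ^ n * p t⌋ : ℤ) ≤ ⌊2 ^ m * (2 ^ n * p t)⌋ :=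
      Int.le_floor.2 (by push_cast; exact h5)
    have h8 : (0 : ℤ) < 2 ^ m := by positivity
    linarith
  · have h7 : (⌊2 ^ m * (2 ^ n * p t)⌋ : ℝ) ≤ 2 ^ m * ⌊2 ^ n * p t⌋ + 2 ^ m := by linarith
    have h8 : ⌊2 ^ m * (2 ^ n * p t)⌋ ≤ 2 ^ m * ⌊2 ^ n * p t⌋ + 2 ^ m := by exact_mod_cast h7
    linarith

/-- The contributing indices lie within R + 1 of `dyadicFloor n p`, and R + 1 ≤ 2R because 1 ≤ R. -/
lemma dist_iterate_dyadicFloor_sq_le {R : ℤ} (hR1 : 1 ≤ R)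
    (hR : ∀ i, a.coeff i ≠ 0 → ∀ t, |i t| ≤ R) {x : (Fin s → ℤ) → X} {B : ℝ} {n : ℕ}
    (hosc : OscLE (2 * R) (a.barycenter^[n] x) B) (m : ℕ) (p : Fin s → ℝ) :
    dist (a.barycenter^[m + n] x (dyadicFloor (m + n) p)) (a.barycenter^[n] x (dyadicFloor n p)) ^ 2
      ≤ B := by
  rw [Function.iterate_add_apply]
  refine (a.dist_iterate_sq_le_op_pow m _ _ _).trans ?_
  refine (a.op_pow_le_op_pow hR m _ (v := fun _ => B) fun k hk => ?_).trans_eq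
    (congrFun (a.op_pow_const m B) _)
  refine hosc _ _ fun t => ?_
  have hpow : (0 : ℤ) < 2 ^ m := by positivity
  have h1 := abs_le.1 (abs_dyadicFloor_sub_le n m p t)
  have h2 := abs_le.1 (hk t)
  rw [abs_le]
  constructor <;> refine le_of_mul_le_mul_left ?_ hpow <;> nlinarith

theorem convergent_barycentricScheme_of_linear (h : a.linearScheme.Convergent) :
    (a.barycentricScheme X).Convergent := by
  intro x
  obtain ⟨R, hR1, hR⟩ := a.exists_radius
  set u : ℕ → (Fin s → ℤ) → X := fun n => a.barycenter^[n] x.1 with hu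
  have hcoe : ∀ n, ((a.barycentricScheme X)^[n] x : BoundedSeq s X).1 = u n := by
    intro n
    induction n with
    | zero => rfl
    | succ n ih =>
      rw [Function.iterate_succ_apply', hu]
      simp only [Function.iterate_succ_apply']
      exact congrArg a.barycenter ih
  have hosc : ∀ ε : ℝ, 0 < ε → ∃ n₀, ∀ n, n₀ ≤ n → OscLE (2 * R) (u n) (ε ^ 2) := fun ε hε =>
    a.exists_oscLE_iterate h hR1 hR x.2 (by positivity)
  have hstep : ∀ ε : ℝ, 0 < ε → ∃ n₀, ∀ n, n₀ ≤ n → ∀ m p,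
      dist (u (m + n) (dyadicFloor (m + n) p)) (u n (dyadicFloor n p)) ≤ ε := by
    intro ε hε
    obtain ⟨n₀, hn₀⟩ := hosc ε hε
    exact ⟨n₀, fun n hn m p => abs_le_of_sq_le_sq'
      (a.dist_iterate_dyadicFloor_sq_le hR1 hR (hn₀ n hn) m p) hε.le |>.2⟩
  have hcau : ∀ p, CauchySeq fun n => u n (dyadicFloor n p) := by
    intro p
    rw [Metric.cauchySeq_iff']
    intro ε hε
    obtain ⟨n₀, hn₀⟩ := hstep (ε / 2) (by linarith)
    refine ⟨n₀, fun n hn => ?_⟩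
    obtain ⟨m, rfl⟩ := Nat.exists_eq_add_of_le' hn
    exact (hn₀ n₀ le_rfl m p).trans_lt (by linarith)
  choose f hf using fun p => cauchySeq_tendsto_of_complete (hcau p)
  have hunif : ∀ ε : ℝ, 0 < ε → ∃ n₀, ∀ n, n₀ ≤ n → ∀ p,
      dist (f p) (u n (dyadicFloor n p)) ≤ ε := by
    intro ε hε
    obtain ⟨n₀, hn₀⟩ := hstep ε hε
    refine ⟨n₀, fun n hn p => ?_⟩
    have h1 := ((tendsto_add_atTop_iff_nat n).2 (hf p)).dist
      (tendsto_const_nhds (x := u n (dyadicFloor n p)))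
    exact le_of_tendsto' h1 fun m => hn₀ n hn m p
  refine ⟨f, ?_, ?_⟩
  · refine Metric.continuous_iff.2 fun p ε hε => ?_
    obtain ⟨n₁, hn₁⟩ := hunif (ε / 4) (by linarith)
    obtain ⟨n₂, hn₂⟩ := hosc (ε / 4) (by linarith)
    set n := max n₁ n₂
    have hpow : (0 : ℝ) < 2 ^ n := by positivity
    refine ⟨1 / 2 ^ n, by positivity, fun q hq => ?_⟩
    -- Points closer than 2⁻ⁿ have floors differing by at most 1 in each coordinate, within the
    -- range controlled by `OscLE`.
    have h1 : dist (u n (dyadicFloor n q)) (u n (dyadicFloor n p)) ≤ ε / 4 := by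
      refine (abs_le_of_sq_le_sq' (hn₂ n (le_max_right _ _) _ _ fun t => ?_) (by linarith)).2
      have h2 := (dist_le_pi_dist q p t).trans_lt hq
      rw [Real.dist_eq, lt_div_iff₀ hpow] at h2
      have h3 : |2 ^ n * q t - 2 ^ n * p t| < 1 := by
        rwa [← mul_sub, abs_mul, abs_of_pos hpow, mul_comm]
      rw [abs_lt] at h3
      have h5 : ⌊2 ^ n * q t⌋ ≤ ⌊2 ^ n * p t⌋ + 1 := by
        rw [← Int.floor_add_one]
        exact Int.floor_le_floor (by linarith)
      have h6 : ⌊2 ^ n * p t⌋ ≤ ⌊2 ^ n * q t⌋ + 1 := by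
        rw [← Int.floor_add_one]
        exact Int.floor_le_floor (by linarith)
      unfold dyadicFloor
      rw [abs_le]
      constructor <;> linarith
    have h2 := hn₁ n (le_max_left _ _) q
    have h3 := hn₁ n (le_max_left _ _) p
    rw [dist_comm] at h3
    have h4 := dist_triangle4 (f q) (u n (dyadicFloor n q)) (u n (dyadicFloor n p)) (f p)
    linarith
  · rw [ENNReal.tendsto_nhds_zero]
    intro ε hε
    obtain ⟨δ, hδ0, hδ⟩ : ∃ δ : ℝ, 0 < δ ∧ ENNReal.ofReal δ ≤ ε := by
      refine ⟨(min ε 1).toReal, ENNReal.toReal_pos (by simp [hε.ne']) (by simp), ?_⟩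
      rw [ENNReal.ofReal_toReal (by simp)]
      exact min_le_left _ _
    obtain ⟨n₀, hn₀⟩ := hunif δ hδ0
    filter_upwards [eventually_ge_atTop n₀] with n hn
    refine iSup_le fun j => ?_
    rw [hcoe, edist_dist]
    refine (ENNReal.ofReal_le_ofReal ?_).trans hδ
    have h1 := hn₀ n hn fun k => (j k : ℝ) / 2 ^ n
    -- Sampling is exact at the dyadic grid, so the uniform estimate is the required supremum bound.
    have h2 : dyadicFloor n (fun k => (j k : ℝ) / 2 ^ n) = j := by
      funext t
      unfold dyadicFloor
      rw [mul_div_cancel₀ _ (by positivity), Int.floor_intCast]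
    rwa [h2] at h1

end Hadamard

/-! ### The real line and change of universe -/

lemma barycenter_eq_op (x : (Fin s → ℤ) → ℝ) (i : Fin s → ℤ) : a.barycenter x i = a.op x i := by
  set b := a.op x i with hb
  -- Completing the square; the cross term vanishes because the weights sum to 1.
  have hE : ∀ p, a.energy x i p = a.energy x i b + (p - b) ^ 2 := by
    intro p
    have h1 : (fun j => dist (x j) p ^ 2) = (fun j => dist (x j) b ^ 2) +
        (2 * (b - p)) • x + fun _ => p ^ 2 - b ^ 2 := by
      funext j
      simp only [Real.dist_eq, sq_abs, Pi.add_apply, Pi.smul_apply, smul_eq_mul]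
      ring
    rw [energy_eq_op, h1, map_add, map_add, map_smul, op_const, energy_eq_op]
    simp only [Pi.add_apply, Pi.smul_apply, smul_eq_mul, ← hb]
    ring
  have h1 := a.barycenter_spec x i b
  rw [hE (a.barycenter x i)] at h1
  have h2 : (a.barycenter x i - b) ^ 2 = 0 := le_antisymm (by linarith) (sq_nonneg _)
  exact sub_eq_zero.1 (pow_eq_zero_iff two_ne_zero |>.1 h2)

lemma barycentricScheme_real : a.barycentricScheme ℝ = a.linearScheme := by
  funext x
  refine Subtype.ext (funext fun i => ?_)
  exact (a.barycenter_eq_op x.1 i).trans (a.op_eq_finsum x.1 i)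

/-- Condition (1) ranges over spaces in an arbitrary universe, so it reaches ℝ only through `ULift
ℝ`. -/
instance instIsHadamardULift {X : Type*} [MetricSpace X] [IsHadamard X] :
    IsHadamard (ULift X) where
  exists_midpoint x₀ x₁ :=
    let ⟨y, hy⟩ := IsHadamard.exists_midpoint x₀.down x₁.down
    ⟨⟨y⟩, fun z => hy z.down⟩

lemma down_barycenter {X : Type*} [MetricSpace X] [IsHadamard X]
    (x : (Fin s → ℤ) → ULift X) (i : Fin s → ℤ) :
    (a.barycenter x i).down = a.barycenter (fun j => (x j).down) i :=
  (a.existsUnique_minimizer (fun j => (x j).down) i).unique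
    (fun q => a.barycenter_spec x i ⟨q⟩) (a.barycenter_spec _ i)

lemma convergent_of_ulift {X : Type*} [MetricSpace X] [IsHadamard X]
    (h : (a.barycentricScheme (ULift X)).Convergent) : (a.barycentricScheme X).Convergent := by
  intro x
  have hb : Bornology.IsBounded (Set.range fun j => ULift.up (x j)) :=
    Metric.isBounded_range_iff.2 <| by
      have := Metric.isBounded_range_iff.1 x.2
      exact this
  obtain ⟨f, hf, hlim⟩ := h ⟨fun j => ULift.up (x j), hb⟩
  refine ⟨fun p => (f p).down, continuous_uliftDown.comp hf, ?_⟩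
  have hcoe : ∀ n j, (((a.barycentricScheme (ULift X))^[n] ⟨fun j => ULift.up (x j), hb⟩ :
      BoundedSeq s (ULift X)) j).down = ((a.barycentricScheme X)^[n] x) j := by
    intro n
    induction n with
    | zero => exact fun j => rfl
    | succ n ih =>
      intro j
      have h1 := Function.iterate_succ_apply' (a.barycentricScheme X) n x
      have h2 := Function.iterate_succ_apply' (a.barycentricScheme (ULift X)) n
        ⟨fun j => ULift.up (x j), hb⟩
      refine (congrArg (fun z => (z.1 j).down) h2).trans (Eq.trans ?_
        (congrArg (fun z => z.1 j) h1.symm))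
      exact (a.down_barycenter _ j).trans (congrArg (fun y => a.barycenter y j) (funext ih))
  simp only [← hcoe]
  exact hlim

end Mask

theorem mainTheorem1 {s : ℕ} (a : Mask s) :
    List.TFAE [
      ∀ (X : Type*) [MetricSpace X] [IsHadamard X], (a.barycentricScheme X).Convergent,
      (a.barycentricScheme ℝ).Convergent,
      a.linearScheme.Convergent] := by
  tfae_have 1 → 2 := fun h => a.convergent_of_ulift (h (ULift ℝ))
  tfae_have 2 → 3 := fun h => a.barycentricScheme_real ▸ h
  tfae_have 3 → 1 := fun h X _ _ => a.convergent_barycentricScheme_of_linear h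
  tfae_finish
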